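/- Let $v>0$ and $r\ge 0$ be real numbers. An admissible configuration (of balls of radius $r$ on the real line) is a bi-infinite sequence of real numbers $x=(x_i)_{i\in\mathbb Z}$ (the centres of the balls) with $x_i+r\le x_{i+1}-r$ for all $i\in\mathbb Z$; the particles are indistinguishable, that is, two sequences that differ only by a shift of the index, $y_i=x_{i+k}$ for all $i$ with some fixed $k\in\mathbb Z$, are regarded as the same configuration. Let $X$ be the space of these configurations, with the $\sigma$-algebra consisting of the sets whose preimage in the space of admissible sequences belongs to the $\sigma$-algebra generated by the finite cylinders $\{x:\ x_i\in C_i\ \forall i\in I\}$ ($I\subset\mathbb Z$ finite, $C_i\subset\mathbb R$ open intervals). The deterministic traffic map in the continuum $T_v:X\to X$ is given by $$(T_v x)_i=\min\{x_i+v,\ x_{i+1}-2r\},\qquad i\in\mathbb Z.$$ Define the topological entropy $h_{\rm top}(T_v)$ as the supremum of the metric (Kolmogorov–Sinai) entropies $h_\mu(T_v)$ over all $T_v$-invariant probability measures $\mu$ on $X$. Then $h_{\rm top}(T_v)=\infty$. -/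

import Mathlib

open MeasureTheory Filter

noncomputable section

/-! ## Metric entropy and topological entropy of a measurable dynamical system -/

section Entropy

variable {α : Type*} [MeasurableSpace α]

/-- The Shannon entropy (natural logarithm) `H_μ(P ∨ T⁻¹P ∨ ⋯ ∨ T⁻⁽ⁿ⁻¹⁾P)` of the `n`-fold
refinement of the finite partition `P = {f⁻¹(a)}` of `α`, given by its labelling `f : α → Fin k`.
The cells of the refinement are indexed by the words `w` of length `n`; some may be empty, and
these contribute `0`. -/
def iteratedPartitionEntropy (T : α → α) (μ : Measure α) {k : ℕ} (f : α → Fin k) (n : ℕ) : ℝ :=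
  ∑ w : Fin n → Fin k, Real.negMulLog (μ.real {x | ∀ j : Fin n, f (T^[j] x) = w j})

/-- The entropy `h_μ(T, P) = lim (1/n) H_μ(P ∨ T⁻¹P ∨ ⋯ ∨ T⁻⁽ⁿ⁻¹⁾P)` of `T` with respect to the
finite measurable partition `P` with labelling `f`. The limit exists whenever `μ` is a
`T`-invariant probability measure, by subadditivity, so that the upper limit is the limit. -/
def partitionEntropy (T : α → α) (μ : Measure α) {k : ℕ} (f : α → Fin k) : ENNReal :=
  limsup (fun n : ℕ => ENNReal.ofReal (iteratedPartitionEntropy T μ f n / n)) atTop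

/-- The metric (Kolmogorov–Sinai) entropy `h_μ(T)`: the supremum of `h_μ(T, P)` over all finite
measurable partitions `P`. -/
def metricEntropy (T : α → α) (μ : Measure α) : ENNReal :=
  ⨆ (k : ℕ) (f : α → Fin k) (_ : Measurable f), partitionEntropy T μ f

/-- The topological entropy `h_top(T)`: the supremum of the metric entropies of `T` over all
`T`-invariant probability measures. -/
def topologicalEntropy (T : α → α) : ENNReal :=
  ⨆ (μ : Measure α) (_ : IsProbabilityMeasure μ) (_ : MeasurePreserving T μ μ), metricEntropy T μ

end Entropy

/-! ## The deterministic traffic map in the continuum -/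

/-- Admissible configurations of labelled particles on the line: bi-infinite sequences of centres
of balls of radius `r` with `x i + r ≤ x (i + 1) - r` for all `i`. The `σ`-algebra inherited from
the product `ℤ → ℝ` is the one generated by the finite cylinders `{x | ∀ i ∈ I, x i ∈ C i}`,
with `I` finite and all `C i` open intervals. -/
def LabelledConfig (r : ℝ) : Type :=
  {x : ℤ → ℝ // ∀ i, x i + r ≤ x (i + 1) - r}

instance (r : ℝ) : MeasurableSpace (LabelledConfig r) :=
  inferInstanceAs (MeasurableSpace {x : ℤ → ℝ // ∀ i, x i + r ≤ x (i + 1) - r})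

/-- Two labelled configurations differ only in the labels of the particles if one is obtained from
the other by an (order preserving) relabelling `i ↦ i + k`. -/
instance relabelling (r : ℝ) : Setoid (LabelledConfig r) where
  r x y := ∃ k : ℤ, ∀ i, y.1 i = x.1 (i + k)
  iseqv :=
    { refl := fun x => ⟨0, fun i => by simp⟩
      symm := by
        rintro x y ⟨k, h⟩
        exact ⟨-k, fun i => by simp [h]⟩
      trans := by
        rintro x y z ⟨k, h⟩ ⟨l, h'⟩
        exact ⟨l + k, fun i => by rw [h', h, add_assoc]⟩ }

/-- Admissible configurations of indistinguishable particles: labelled configurations up to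
relabelling. -/
def Config (r : ℝ) : Type := Quotient (relabelling r)

/-- A set of configurations of indistinguishable particles is measurable if the corresponding
(relabelling invariant) set of labelled configurations is. -/
instance (r : ℝ) : MeasurableSpace (Config r) :=
  inferInstanceAs (MeasurableSpace (Quotient (relabelling r)))

/-- One step of the dynamics of labelled particles: every particle moves to the right by `v`, or
as far as the position that its right neighbour had at the beginning of the step permits. -/
def labelledTrafficMap (r v : ℝ) (hv : 0 < v) (x : LabelledConfig r) : LabelledConfig r :=
  ⟨fun i => min (x.1 i + v) (x.1 (i + 1) - 2 * r), fun i => by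
    have h := x.2 (i + 1)
    have h1 := min_le_right (x.1 i + v) (x.1 (i + 1) - 2 * r)
    have h2 : x.1 (i + 1) ≤ min (x.1 (i + 1) + v) (x.1 (i + 1 + 1) - 2 * r) :=
      le_min (by linarith) (by linarith)
    linarith⟩

/-- The traffic map in the continuum, acting on configurations of indistinguishable particles. -/
def trafficMap (r v : ℝ) (hv : 0 < v) : Config r → Config r :=
  Quotient.map (labelledTrafficMap r v hv) (by
    rintro x y ⟨k, h⟩
    refine ⟨k, fun i => ?_⟩
    simp only [labelledTrafficMap, h, add_right_comm])

end

/-!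
If all gaps `x (i + 1) - x i` are at least `v + 2 * r`, no particle is blocked and the traffic map
is the translation by `v`. Fix `N` with `2 * v + 2 * r ≤ N * v` and an alphabet of `K + 1` letters.
A sequence of letters `ω : ℤ → Fin (K + 1)` is encoded by the configuration with particles at
`i * N * v + v * ω i / (K + 1)`, all of whose gaps are large enough. Translating it by `N * v`
amounts, after relabelling the particles, to shifting the sequence `ω`; so the `N`-th iterate of the
traffic map contains a full shift on `K + 1` letters (`encode_add`, `trafficMap_iterate_encode`).
The uniform Bernoulli measure on sequences therefore yields a measure that is invariant under the
`N`-th iterate, and averaging it over `N` consecutive times gives an invariant probability measure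
of the traffic map (`measurePreserving_orbitAverage`).

Observing which of the points `v * a / (K + 1)`, `a ≤ K`, are occupied defines a finite partition.
An observation over `N * m` units of time reads off `m` letters of `ω`, whatever the phase, so that
each cell of the refined partition has measure at most `(K + 1) ^ (-m)`
(`encodedMeasure_cell_le`). The entropy of the invariant measure is thus at least
`log (K + 1) / N`. As `N` does not depend on `K`, this is unbounded.
-/

/-! ### Lower bounds for the entropy -/

section EntropyBounds

variable {α : Type*} [MeasurableSpace α]

theorem measurable_itinerary {T : α → α} (hT : Measurable T) {k : ℕ} {f : α → Fin k}
    (hf : Measurable f) (n : ℕ) : Measurable fun x => fun j : Fin n => f (T^[j] x) :=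
  measurable_pi_lambda _ fun j => hf.comp (hT.iterate j)

/-- If all cells of a refined partition have measure at most `exp (-c)`, then the information
function is at least `c`, and so is its mean, the entropy. -/
theorem le_iteratedPartitionEntropy {T : α → α} (hT : Measurable T) (μ : Measure α)
    [IsProbabilityMeasure μ] {k : ℕ} {f : α → Fin k} (hf : Measurable f) {n : ℕ} {c : ℝ}
    (h : ∀ w : Fin n → Fin k, μ.real {x | ∀ j : Fin n, f (T^[j] x) = w j} ≤ Real.exp (-c)) :
    c ≤ iteratedPartitionEntropy T μ f n := by
  have hcell : ∀ w : Fin n → Fin k, {x | ∀ j : Fin n, f (T^[j] x) = w j} =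
      (fun x => fun j : Fin n => f (T^[j] x)) ⁻¹' {w} := fun w => by
    ext x
    simp [funext_iff]
  have hsum : ∑ w : Fin n → Fin k, μ.real {x | ∀ j : Fin n, f (T^[j] x) = w j} = 1 := by
    simp_rw [hcell]
    rw [sum_measureReal_preimage_singleton _
      fun w _ => measurable_itinerary hT hf n (measurableSet_singleton w)]
    simp
  calc c = ∑ w : Fin n → Fin k, μ.real {x | ∀ j : Fin n, f (T^[j] x) = w j} * c := by
        rw [← Finset.sum_mul, hsum, one_mul]
    _ ≤ _ := Finset.sum_le_sum fun w _ => by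
        rcases measureReal_nonneg.eq_or_lt' (a := μ.real {x | ∀ j : Fin n, f (T^[j] x) = w j})
          with h0 | h0
        · simp [h0]
        · have hlog := (Real.log_le_iff_le_exp h0).2 (h w)
          rw [Real.negMulLog]
          nlinarith

/-- An upper limit is at least any lower bound that holds frequently, here at the multiples of `N`. -/
theorem le_partitionEntropy {T : α → α} {μ : Measure α} {k : ℕ} {f : α → Fin k} {N : ℕ}
    (hN : N ≠ 0) {c : ℝ} (h : ∀ m : ℕ, m * c ≤ iteratedPartitionEntropy T μ f (N * m)) :
    ENNReal.ofReal (c / N) ≤ partitionEntropy T μ f := by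
  refine le_limsup_of_frequently_le' (frequently_atTop.2 fun a => ⟨N * (a + 1), ?_, ?_⟩)
  · nlinarith [Nat.one_le_iff_ne_zero.2 hN]
  · refine ENNReal.ofReal_le_ofReal ?_
    have hN' : (0 : ℝ) < N := by positivity
    rw [div_le_div_iff₀ hN' (by positivity)]
    have := mul_le_mul_of_nonneg_right (h (a + 1)) hN'.le
    push_cast at this ⊢
    linarith

theorem le_topologicalEntropy {T : α → α} {μ : Measure α} [IsProbabilityMeasure μ]
    (hT : MeasurePreserving T μ μ) {k : ℕ} {f : α → Fin k} (hf : Measurable f) :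
    partitionEntropy T μ f ≤ topologicalEntropy T :=
  le_iSup_of_le μ <| le_iSup_of_le inferInstance <| le_iSup_of_le hT <|
    le_iSup_of_le k <| le_iSup_of_le f <| le_iSup_of_le hf le_rfl

end EntropyBounds

/-! ### Averages of a measure along an orbit -/

section OrbitAverage

variable {α : Type*} [MeasurableSpace α]

/-- The average of the images of `ν` at the times `1, …, N`. Starting at time `1` rather than `0`
makes every phase see exactly `m` multiples of `N` within the first `N * m` steps. -/
noncomputable def orbitAverage (T : α → α) (ν : Measure α) (N : ℕ) : Measure α :=
  (N : ENNReal)⁻¹ • ∑ j ∈ Finset.range N, ν.map T^[j + 1]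

theorem orbitAverage_apply {T : α → α} (ν : Measure α) (N : ℕ) (s : Set α) :
    orbitAverage T ν N s = (N : ENNReal)⁻¹ * ∑ j ∈ Finset.range N, ν.map T^[j + 1] s := by
  simp [orbitAverage]

theorem orbitAverage_le {T : α → α} {ν : Measure α} {N : ℕ} (hN : N ≠ 0) {s : Set α} {c : ENNReal}
    (h : ∀ j < N, ν.map T^[j + 1] s ≤ c) : orbitAverage T ν N s ≤ c := by
  rw [orbitAverage_apply]
  calc _ ≤ (N : ENNReal)⁻¹ * ∑ _j ∈ Finset.range N, c := by
        gcongr with j hj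
        exact h j (Finset.mem_range.1 hj)
    _ = c := by
        rw [Finset.sum_const, Finset.card_range, nsmul_eq_mul, ← mul_assoc,
          ENNReal.inv_mul_cancel (by exact_mod_cast hN) (by simp), one_mul]

theorem isProbabilityMeasure_orbitAverage {T : α → α} (hT : Measurable T) (ν : Measure α)
    [IsProbabilityMeasure ν] {N : ℕ} (hN : N ≠ 0) :
    IsProbabilityMeasure (orbitAverage T ν N) := by
  refine ⟨?_⟩
  have h : ∀ j ∈ Finset.range N, ν.map T^[j + 1] Set.univ = 1 := fun j _ => by
    rw [Measure.map_apply (hT.iterate _) .univ]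
    simp
  rw [orbitAverage_apply, Finset.sum_congr rfl h]
  simp [ENNReal.inv_mul_cancel (a := (N : ENNReal)) (by exact_mod_cast hN) (by simp)]

theorem measurePreserving_orbitAverage {T : α → α} {ν : Measure α} {N : ℕ} (hT : Measurable T)
    (hν : ν.map T^[N] = ν) :
    MeasurePreserving T (orbitAverage T ν N) (orbitAverage T ν N) := by
  refine ⟨hT, ?_⟩
  have hmap : ∀ j, (ν.map T^[j]).map T = ν.map T^[j + 1] := fun j => by
    rw [Measure.map_map hT (hT.iterate j), Function.iterate_succ']
  have hsum : ∑ j ∈ Finset.range N, ν.map T^[j + 1 + 1] =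
      ∑ j ∈ Finset.range N, ν.map T^[j + 1] := by
    cases N with
    | zero => simp
    | succ M =>
      rw [Finset.sum_range_succ, Finset.sum_range_succ', ← hmap (M + 1), hν, zero_add,
        Function.iterate_one]
  rw [orbitAverage, Measure.map_smul, ← Measure.mapₗ_apply_of_measurable hT, map_sum]
  simp_rw [Measure.mapₗ_apply_of_measurable hT, hmap, hsum]

end OrbitAverage

/-! ### The uniform Bernoulli shift -/

/-- The uniform measure on `K + 1` letters. -/
noncomputable def uniformLetter (K : ℕ) : Measure (Fin (K + 1)) :=
  ProbabilityTheory.uniformOn Set.univ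

instance (K : ℕ) : IsProbabilityMeasure (uniformLetter K) :=
  ProbabilityTheory.isProbabilityMeasure_uniformOn Set.finite_univ Set.univ_nonempty

theorem uniformLetter_le_of_subsingleton {K : ℕ} {s : Set (Fin (K + 1))} (hs : s.Subsingleton) :
    uniformLetter K s ≤ ((K + 1 : ℕ) : ENNReal)⁻¹ := by
  rw [uniformLetter, ProbabilityTheory.uniformOn_univ, ENNReal.div_eq_inv_mul, Fintype.card_fin]
  refine mul_le_of_le_one_right' ?_
  rcases hs.eq_empty_or_singleton with rfl | ⟨a, rfl⟩ <;> simp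

/-- The law of a bi-infinite sequence of independent uniform letters. -/
noncomputable def bernoulliMeasure (K : ℕ) : Measure (ℤ → Fin (K + 1)) :=
  Measure.infinitePi fun _ => uniformLetter K

instance (K : ℕ) : IsProbabilityMeasure (bernoulliMeasure K) :=
  inferInstanceAs (IsProbabilityMeasure (Measure.infinitePi _))

/-- The shift of bi-infinite sequences to the right. -/
def shift {β : Type*} (ω : ℤ → β) : ℤ → β := fun i => ω (i - 1)

theorem measurable_shift {β : Type*} [MeasurableSpace β] : Measurable (shift (β := β)) :=
  measurable_pi_lambda _ fun i => measurable_pi_apply (i - 1)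

theorem bernoulliMeasure_map_shift (K : ℕ) : (bernoulliMeasure K).map shift = bernoulliMeasure K :=
  Measure.map_infinitePi_infinitePi_of_inj (sub_left_injective (b := (1 : ℤ)))

theorem bernoulliMeasure_le {K : ℕ} (m : ℕ) {s : ℕ → Set (Fin (K + 1))}
    (hs : ∀ q, (s q).Subsingleton) :
    bernoulliMeasure K {ω | ∀ q < m, ω (-(q + 1 : ℕ)) ∈ s q} ≤ ((K + 1 : ℕ) : ENNReal)⁻¹ ^ m := by
  let e : ℕ ↪ ℤ := ⟨fun q => -(q + 1 : ℕ), fun a b h => by simpa using h⟩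
  have hset : {ω : ℤ → Fin (K + 1) | ∀ q < m, ω (-(q + 1 : ℕ)) ∈ s q} =
      Set.pi ((Finset.range m).map e) fun i => s (-i - 1).toNat := by
    ext ω
    simp [Set.mem_pi, e]
  rw [hset, bernoulliMeasure, Measure.infinitePi_pi _ fun _ _ => (Set.toFinite _).measurableSet]
  calc _ ≤ ∏ _i ∈ (Finset.range m).map e, ((K + 1 : ℕ) : ENNReal)⁻¹ :=
        Finset.prod_le_prod' fun i _ => uniformLetter_le_of_subsingleton (hs _)
    _ = _ := by simp

/-! ### The traffic map on sparse configurations -/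

theorem LabelledConfig.measurable_position {r : ℝ} (i : ℤ) :
    Measurable fun x : LabelledConfig r => x.1 i :=
  (measurable_pi_apply i).comp measurable_subtype_coe

theorem measurable_trafficMap {r v : ℝ} (hv : 0 < v) : Measurable (trafficMap r v hv) := by
  refine measurable_from_quotient.2 ?_
  have hlab : Measurable (labelledTrafficMap r v hv) := by
    refine Measurable.subtype_mk (measurable_pi_lambda _ fun i => ?_)
    exact ((LabelledConfig.measurable_position i).add_const v).min
      ((LabelledConfig.measurable_position (i + 1)).sub_const (2 * r))
  exact measurable_quotient_mk'.comp hlab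

section Encoding

variable {r v : ℝ} {N K : ℕ}

/-- The positions of the particles that encode the sequence of letters `ω`, after `s` free moves. -/
noncomputable def encodePosition (v : ℝ) (N : ℕ) (ω : ℤ → Fin (K + 1)) (s : ℕ) (i : ℤ) : ℝ :=
  (i * N + s) * v + v * ((ω i : ℕ) / (K + 1))

theorem encodePosition_gap (hv : 0 < v) (hN : 2 * v + 2 * r ≤ N * v) (ω : ℤ → Fin (K + 1))
    (s : ℕ) (i : ℤ) :
    encodePosition v N ω s i + v ≤ encodePosition v N ω s (i + 1) - 2 * r := by
  have h1 : ((ω i : ℕ) : ℝ) / (K + 1) ≤ 1 := by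
    rw [div_le_one (by positivity)]
    exact_mod_cast (ω i).2.le
  have h2 : (0 : ℝ) ≤ v * (((ω (i + 1) : ℕ) : ℝ) / (K + 1)) := by positivity
  have h3 := mul_le_mul_of_nonneg_left h1 hv.le
  simp only [encodePosition]
  push_cast
  linarith

/-- The labelled configuration that encodes the sequence `ω`, after `s` free moves. -/
noncomputable def labelledEncode (hv : 0 < v) (hN : 2 * v + 2 * r ≤ N * v) (s : ℕ)
    (ω : ℤ → Fin (K + 1)) :
    LabelledConfig r :=
  ⟨encodePosition v N ω s, fun i => by linarith [encodePosition_gap hv hN ω s i]⟩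

/-- The configuration that encodes the sequence `ω`, after `s` free moves. -/
noncomputable def encode (hv : 0 < v) (hN : 2 * v + 2 * r ≤ N * v) (s : ℕ)
    (ω : ℤ → Fin (K + 1)) : Config r :=
  Quotient.mk _ (labelledEncode hv hN s ω)

theorem measurable_encode (hv : 0 < v) (hN : 2 * v + 2 * r ≤ N * v) (s : ℕ) :
    Measurable (encode (K := K) hv hN s) := by
  refine measurable_quotient_mk'.comp (Measurable.subtype_mk (measurable_pi_lambda _ fun i => ?_))
  exact (measurable_of_countable
    fun a : Fin (K + 1) => (i * N + s) * v + v * (((a : ℕ) : ℝ) / (K + 1))).comp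
      (measurable_pi_apply i)

theorem trafficMap_encode (hv : 0 < v) (hN : 2 * v + 2 * r ≤ N * v) (s : ℕ)
    (ω : ℤ → Fin (K + 1)) : trafficMap r v hv (encode hv hN s ω) = encode hv hN (s + 1) ω := by
  refine congrArg (Quotient.mk _) (Subtype.ext (funext fun i => ?_))
  refine (min_eq_left (encodePosition_gap hv hN ω s i)).trans ?_
  change _ = encodePosition v N ω (s + 1) i
  simp only [encodePosition]
  push_cast
  ring

theorem trafficMap_iterate_encode (hv : 0 < v) (hN : 2 * v + 2 * r ≤ N * v) (s t : ℕ)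
    (ω : ℤ → Fin (K + 1)) :
    (trafficMap r v hv)^[t] (encode hv hN s ω) = encode hv hN (s + t) ω := by
  induction t with
  | zero => rfl
  | succ t ih => rw [Function.iterate_succ_apply', ih, trafficMap_encode, add_assoc]

/-- Particle `i` of the translate by `N * v` plays the role of particle `i + 1` of the shifted
sequence. -/
theorem encode_add (hv : 0 < v) (hN : 2 * v + 2 * r ≤ N * v) (s : ℕ) (ω : ℤ → Fin (K + 1)) :
    encode hv hN (s + N) ω = encode hv hN s (shift ω) := by
  refine Quotient.sound ⟨-1, fun i => ?_⟩
  change encodePosition v N (shift ω) s i = encodePosition v N ω (s + N) (i + -1)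
  simp only [encodePosition, shift, ← sub_eq_add_neg]
  push_cast
  ring

/-! ### Observing the letters -/

/-- Some particle of the configuration has its centre at `c`. -/
def IsOccupied (c : ℝ) : Config r → Prop :=
  Quotient.lift (fun x => ∃ i, x.1 i = c) (by
    rintro x y ⟨k, h⟩
    refine propext ⟨fun ⟨i, hi⟩ => ⟨i - k, ?_⟩, fun ⟨i, hi⟩ => ⟨i + k, ?_⟩⟩
    · rw [h, sub_add_cancel, hi]
    · rw [← h, hi])

theorem measurableSet_isOccupied (c : ℝ) : MeasurableSet {x : Config r | IsOccupied c x} := by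
  change MeasurableSet {x : LabelledConfig r | ∃ i, x.1 i = c}
  rw [Set.ofPred_exists]
  exact .iUnion fun i => LabelledConfig.measurable_position i (measurableSet_singleton c)

open Classical in
/-- The set of those letters `a` for which there is a particle at `v * a / (K + 1)`, as an element
of a finite type. -/
noncomputable def observe (v : ℝ) (K : ℕ) (x : Config r) :
    Fin (Fintype.card (Fin (K + 1) → Bool)) :=
  Fintype.equivFin _ fun a => decide (IsOccupied (v * ((a : ℕ) / (K + 1))) x)

theorem measurable_observe : Measurable (observe (r := r) v K) := by
  classical
  refine (measurable_of_countable _).comp (measurable_pi_lambda _ fun a => ?_)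
  refine measurable_to_bool ?_
  convert measurableSet_isOccupied (r := r) (v * ((a : ℕ) / (K + 1))) using 1
  ext x
  simp

/-- At the times that are multiples of `N`, exactly one of the sites is occupied: the one that
stands for the current letter. -/
theorem isOccupied_encode (hv : 0 < v) (hN : 2 * v + 2 * r ≤ N * v) (hN0 : N ≠ 0) (q : ℕ)
    (ω : ℤ → Fin (K + 1)) (a : Fin (K + 1)) :
    IsOccupied (v * ((a : ℕ) / (K + 1))) (encode hv hN (q * N) ω) ↔ ω (-q) = a := by
  change (∃ i, encodePosition v N ω (q * N) i = _) ↔ _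
  have hK : (0 : ℝ) < K + 1 := by positivity
  constructor
  · rintro ⟨i, hi⟩
    have h : (i + q) * (N * (K + 1)) + (ω i : ℕ) = ((a : ℕ) : ℤ) := by
      simp only [encodePosition] at hi
      push_cast at hi
      field_simp at hi
      have : ((i + q) * (N * (K + 1)) + (ω i : ℕ) : ℝ) = (a : ℕ) := by linarith
      exact_mod_cast this
    have ha := a.2
    have hω := (ω i).2
    have hNK : (K + 1 : ℤ) ≤ N * (K + 1) := by
      have : (1 : ℤ) ≤ N := by omega
      nlinarith
    have hiq : i + q = 0 := by
      rcases lt_trichotomy (i + q) 0 with h0 | h0 | h0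
      · nlinarith
      · exact h0
      · nlinarith
    have hi' : i = -q := by omega
    subst hi'
    rw [hiq, zero_mul, zero_add] at h
    exact Fin.ext (by exact_mod_cast h)
  · rintro rfl
    refine ⟨-q, ?_⟩
    simp only [encodePosition]
    push_cast
    ring

theorem observe_encode_injective (hv : 0 < v) (hN : 2 * v + 2 * r ≤ N * v) (hN0 : N ≠ 0) (q : ℕ)
    {ω ω' : ℤ → Fin (K + 1)}
    (h : observe v K (encode hv hN (q * N) ω) = observe v K (encode hv hN (q * N) ω')) :
    ω (-q) = ω' (-q) := by
  have h' := congrFun ((Fintype.equivFin _).injective h) (ω' (-q))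
  simpa [isOccupied_encode hv hN hN0] using h'

/-! ### The invariant measure -/

/-- The law of the configuration that encodes a sequence of independent uniform letters. -/
noncomputable def encodedMeasure (K : ℕ) (hv : 0 < v) (hN : 2 * v + 2 * r ≤ N * v) :
    Measure (Config r) :=
  (bernoulliMeasure K).map (encode hv hN 0)

instance (hv : 0 < v) (hN : 2 * v + 2 * r ≤ N * v) :
    IsProbabilityMeasure (encodedMeasure K hv hN) :=
  Measure.isProbabilityMeasure_map (measurable_encode hv hN 0).aemeasurable

theorem encodedMeasure_map_iterate (hv : 0 < v) (hN : 2 * v + 2 * r ≤ N * v) (t : ℕ) :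
    (encodedMeasure K hv hN).map (trafficMap r v hv)^[t] =
      (bernoulliMeasure K).map (encode hv hN t) := by
  rw [encodedMeasure, Measure.map_map ((measurable_trafficMap hv).iterate t)
    (measurable_encode hv hN 0)]
  congr 1
  funext ω
  simp [trafficMap_iterate_encode]

theorem encodedMeasure_map_iterate_self (hv : 0 < v) (hN : 2 * v + 2 * r ≤ N * v) :
    (encodedMeasure K hv hN).map (trafficMap r v hv)^[N] = encodedMeasure K hv hN := by
  have h : encode (K := K) hv hN N = encode hv hN 0 ∘ shift := by
    funext ω
    simpa using encode_add hv hN 0 ω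
  rw [encodedMeasure_map_iterate, h, ← Measure.map_map (measurable_encode hv hN 0) measurable_shift,
    bernoulliMeasure_map_shift, encodedMeasure]

/-- Whatever the phase `j + 1`, an observation during `N * m` units of time reveals the letters
with the labels `-1, …, -m`. -/
theorem encodedMeasure_cell_le (hv : 0 < v) (hN : 2 * v + 2 * r ≤ N * v) {j : ℕ} (hj : j < N)
    (m : ℕ) (w : Fin (N * m) → Fin (Fintype.card (Fin (K + 1) → Bool))) :
    (encodedMeasure K hv hN).map (trafficMap r v hv)^[j + 1]
      {x | ∀ t : Fin (N * m), observe v K ((trafficMap r v hv)^[t] x) = w t} ≤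
        ((K + 1 : ℕ) : ENNReal)⁻¹ ^ m := by
  have hmeas : MeasurableSet
      {x : Config r | ∀ t : Fin (N * m), observe v K ((trafficMap r v hv)^[t] x) = w t} := by
    rw [Set.ofPred_forall]
    exact .iInter fun t =>
      (measurable_observe.comp ((measurable_trafficMap hv).iterate t)) (measurableSet_singleton _)
  rw [encodedMeasure_map_iterate, Measure.map_apply (measurable_encode hv hN _) hmeas]
  -- the letters compatible with what is seen at the time `q * N + (N - 1 - j)`, at which the total
  -- displacement is `(q + 1) * N * v`
  let s : ℕ → Set (Fin (K + 1)) := fun q => {a | ∃ h : q * N + (N - 1 - j) < N * m,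
    ∃ ω : ℤ → Fin (K + 1), ω (-(q + 1 : ℕ)) = a ∧
      observe v K (encode hv hN ((q + 1) * N) ω) = w ⟨_, h⟩}
  have hs : ∀ q, (s q).Subsingleton := by
    rintro q _ ⟨h, ω, rfl, hω⟩ _ ⟨_, ω', rfl, hω'⟩
    exact observe_encode_injective hv hN (by omega) (q + 1) (hω.trans hω'.symm)
  refine (measure_mono fun ω hω q hq => ?_).trans (bernoulliMeasure_le m hs)
  have hlt : q * N + (N - 1 - j) < N * m := by
    have : (q + 1) * N ≤ m * N := Nat.mul_le_mul_right N hq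
    rw [add_mul, one_mul] at this
    rw [mul_comm N m]
    omega
  refine ⟨hlt, ω, rfl, ?_⟩
  have h := hω ⟨_, hlt⟩
  rw [trafficMap_iterate_encode] at h
  rw [← h]
  congr 2
  rw [add_mul, one_mul]
  simp only
  omega

theorem log_div_le_topologicalEntropy (hv : 0 < v) (hN : 2 * v + 2 * r ≤ N * v) (hN0 : N ≠ 0)
    (K : ℕ) :
    ENNReal.ofReal (Real.log (K + 1) / N) ≤ topologicalEntropy (trafficMap r v hv) := by
  have hT := measurable_trafficMap (r := r) hv
  have := isProbabilityMeasure_orbitAverage hT (encodedMeasure K hv hN) hN0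
  refine (le_partitionEntropy hN0 fun m => ?_).trans (le_topologicalEntropy
    (measurePreserving_orbitAverage hT (encodedMeasure_map_iterate_self (K := K) hv hN))
    (measurable_observe (v := v) (K := K)))
  refine le_iteratedPartitionEntropy hT _ measurable_observe fun w => ?_
  have hle := orbitAverage_le hN0 fun j hj => encodedMeasure_cell_le hv hN hj m w
  refine (ENNReal.toReal_mono (by simp) hle).trans_eq ?_
  rw [Real.exp_neg, Real.exp_nat_mul, Real.exp_log (by positivity)]
  rw [ENNReal.toReal_pow, ENNReal.toReal_inv, ENNReal.toReal_natCast, Nat.cast_add_one, inv_pow]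

end Encoding

theorem theoremt (r v : ℝ) (hr : 0 ≤ r) (hv : 0 < v) :
    topologicalEntropy (trafficMap r v hv) = ⊤ := by
  obtain ⟨N, hN⟩ := exists_nat_ge ((2 * v + 2 * r) / v)
  rw [div_le_iff₀ hv] at hN
  have hN0 : N ≠ 0 := by
    rintro rfl
    rw [Nat.cast_zero, zero_mul] at hN
    linarith
  refine ENNReal.eq_top_of_forall_nnreal_le fun c => ?_
  obtain ⟨K, hK⟩ := exists_nat_ge (Real.exp (c * N))
  refine le_trans ?_ (log_div_le_topologicalEntropy hv hN hN0 K)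
  rw [← ENNReal.ofReal_coe_nnreal]
  refine ENNReal.ofReal_le_ofReal ?_
  rw [le_div_iff₀ (by positivity), Real.le_log_iff_exp_le (by positivity)]
  linarith
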